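/- Work over $\mathbb{C}$ and let $[\,,]$ be the commutator bracket of $\mathrm{sl}(2,\mathbb{C})$. A PostLie algebra structure on the Lie algebra $(\mathrm{sl}(2,\mathbb{C}),[\,,])$ is a $\mathbb{C}$-bilinear product $\circ$ on $\mathrm{sl}(2,\mathbb{C})$ such that, for all $x,y,z$, $$z\circ(y\circ x)-y\circ(z\circ x)+(y\circ z)\circ x-(z\circ y)\circ x+[y,z]\circ x=0,\qquad z\circ[x,y]-[z\circ x,y]-[x,z\circ y]=0.$$ Two such structures $\circ$ and $\star$ are isomorphic on the Lie algebra $\mathrm{sl}(2,\mathbb{C})$ if there is an automorphism $f$ of the Lie algebra $\mathrm{sl}(2,\mathbb{C})$ with $f(x\circ y)=f(x)\star f(y)$ for all $x,y$. Consider the basis $$e_1=\frac12\begin{pmatrix}0&1\\-1&0\end{pmatrix},\quad e_2=\frac1{2\sqrt{-1}}\begin{pmatrix}0&1\\1&0\end{pmatrix},\quad e_3=\frac1{2\sqrt{-1}}\begin{pmatrix}1&0\\0&-1\end{pmatrix}$$ of $\mathrm{sl}(2,\mathbb{C})$. Theorem. The following products, extended bilinearly from the basis (with $i,j=1,2,3$),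 form a complete set of representatives, without repetitions, of the isomorphism classes of PostLie algebra structures on the Lie algebra $\mathrm{sl}(2,\mathbb{C})$: 1. $e_i\circ e_j=0$; 2. $e_i\circ e_j=[-e_i,e_j]$; 3. $e_1\circ e_i=[-e_1,e_i]$, $\ e_2\circ e_i=e_3\circ e_i=\left[-\frac{1+\sqrt{-1}}{2}e_2+\frac{\sqrt{-1}-1}{2}e_3,\,e_i\right]$; 4. $e_1\circ e_i=\left[(\sqrt{-1}-\frac12)e_1+(1-\frac{\sqrt{-1}}2)e_2,\,e_i\right]$, $\ e_2\circ e_i=\left[(1+\frac{\sqrt{-1}}2)e_1-(\sqrt{-1}+\frac12)e_2,\,e_i\right]$, $\ e_3\circ e_i=0$; 5. for each $k\in\mathbb{C}$: $e_1\circ e_i=[ke_1,e_i]$, $\ e_2\circ e_i=\left[-\frac12e_2+\frac{\sqrt{-1}}2e_3,\,e_i\right]$, $\ e_3\circ e_i=\left[-\frac{\sqrt{-1}}2e_2-\frac12e_3,\,e_i\right]$. That is, each product in the list is a PostLie algebra structure; every PostLie algebra structure on $\mathrm{sl}(2,\mathbb{C})$ is isomorphic on the Lie algebra $\mathrm{sl}(2,\mathbb{C})$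 to one in the list; and no two different entries of the list (types 1–4, and type 5 for each value of $k$) are isomorphic on the Lie algebra $\mathrm{sl}(2,\mathbb{C})$. -/

import Mathlib

noncomputable section

/-- A PostLie algebra structure on a complex Lie algebra `L`: a bilinear product
`x ∘ y = m x y` on `L` that satisfies the two PostLie identities. (Antisymmetry and the Jacobi
identity of the bracket are part of `L` being a Lie algebra.) -/
structure IsPostLie {L : Type*} [LieRing L] [LieAlgebra ℂ L] (m : L →ₗ[ℂ] L →ₗ[ℂ] L) : Prop where
  assoc_rel : ∀ x y z : L,
    m z (m y x) - m y (m z x) + m (m y z) x - m (m z y) x + m ⁅y, z⁆ x = 0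
  deriv_rel : ∀ x y z : L, m z ⁅x, y⁆ - ⁅m z x, y⁆ - ⁅x, m z y⁆ = 0

/-- Two bilinear products on `L` are isomorphic on the Lie algebra `L` if some automorphism of the
Lie algebra `L` carries one to the other. -/
def IsomorphicOn {L : Type*} [LieRing L] [LieAlgebra ℂ L] (m m' : L →ₗ[ℂ] L →ₗ[ℂ] L) : Prop :=
  ∃ f : L ≃ₗ⁅ℂ⁆ L, ∀ x y : L, f (m x y) = m' (f x) (f y)

/-- The Lie algebra `sl(2, ℂ)` of traceless complex `2 × 2` matrices. -/
abbrev SL2 : Type := LieAlgebra.SpecialLinear.sl (Fin 2) ℂ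

theorem mem_sl2 (x : Matrix (Fin 2) (Fin 2) ℂ) :
    x ∈ LieAlgebra.SpecialLinear.sl (Fin 2) ℂ ↔ x.trace = 0 := Iff.rfl

/-- `e₁ = (1/2) (0, 1; -1, 0)`. -/
def e₁ : SL2 := ⟨(1 / 2 : ℂ) • !![0, 1; -1, 0], by
  rw [mem_sl2]; simp⟩

/-- `e₂ = (1/(2i)) (0, 1; 1, 0)`. -/
def e₂ : SL2 := ⟨(1 / (2 * Complex.I) : ℂ) • !![0, 1; 1, 0], by
  rw [mem_sl2]; simp⟩

/-- `e₃ = (1/(2i)) (1, 0; 0, -1)`. -/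
def e₃ : SL2 := ⟨(1 / (2 * Complex.I) : ℂ) • !![1, 0; 0, -1], by
  rw [mem_sl2]; simp⟩

theorem linearIndependent_e : LinearIndependent ℂ ![e₁, e₂, e₃] := by
  rw [Fintype.linearIndependent_iff]
  intro g hg
  have h := congrArg (fun x : SL2 => (x : Matrix (Fin 2) (Fin 2) ℂ)) hg
  simp only [Fin.sum_univ_three, e₁, e₂, e₃] at h
  have h00 := congrFun (congrFun h 0) 0
  have h01 := congrFun (congrFun h 0) 1
  have h10 := congrFun (congrFun h 1) 0
  simp at h00 h01 h10
  have hI := Complex.I_ne_zero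
  have h0 : g 0 = 0 := by linear_combination h01 - h10
  have h1 : g 1 = 0 := by
    have : g 1 * Complex.I = 0 := by linear_combination - h01 - h10
    simpa [hI] using this
  intro i
  fin_cases i
  · exact h0
  · exact h1
  · exact h00

theorem span_e : ⊤ ≤ Submodule.span ℂ (Set.range ![e₁, e₂, e₃]) := by
  rintro ⟨x, hx⟩ -
  have htr : x 1 1 = - x 0 0 := by
    have := (mem_sl2 x).1 hx
    rw [Matrix.trace_fin_two] at this
    linear_combination this
  rw [Submodule.mem_span_range_iff_exists_fun]
  refine ⟨![x 0 1 - x 1 0, Complex.I * (x 0 1 + x 1 0), 2 * Complex.I * x 0 0], ?_⟩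
  have hI := Complex.I_ne_zero
  apply Subtype.ext
  ext i j
  fin_cases i <;> fin_cases j <;>
    simp [Fin.sum_univ_three, e₁, e₂, e₃, htr] <;> field_simp <;> ring_nf <;>
    simp only [Complex.I_sq] <;> ring

/-- The basis `e₁, e₂, e₃` of `sl(2, ℂ)`. -/
def sl2Basis : Module.Basis (Fin 3) ℂ SL2 := Module.Basis.mk linearIndependent_e span_e

/-- The bilinear product on `sl(2, ℂ)` with `eᵢ ∘ eⱼ = [vᵢ, eⱼ]` for all `i, j`. -/
def prodOf (v : Fin 3 → SL2) : SL2 →ₗ[ℂ] SL2 →ₗ[ℂ] SL2 :=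
  sl2Basis.constr ℂ fun i => sl2Basis.constr ℂ fun j => ⁅v i, sl2Basis j⁆

/-- The labels of the list: four isolated types and a family indexed by `k ∈ ℂ`. -/
inductive Label : Type
  | type1 | type2 | type3 | type4
  | type5 (k : ℂ)

open Complex in
/-- The listed product with a given label. -/
def listed : Label → (SL2 →ₗ[ℂ] SL2 →ₗ[ℂ] SL2)
  | .type1 => 0
  | .type2 => prodOf ![-e₁, -e₂, -e₃]
  | .type3 => prodOf
      ![-e₁,
        -((1 + I) / 2) • e₂ + ((I - 1) / 2) • e₃,
        -((1 + I) / 2) • e₂ + ((I - 1) / 2) • e₃]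
  | .type4 => prodOf
      ![(I - 1 / 2) • e₁ + (1 - I / 2) • e₂,
        (1 + I / 2) • e₁ - (I + 1 / 2) • e₂,
        0]
  | .type5 k => prodOf
      ![k • e₁,
        -(1 / 2 : ℂ) • e₂ + (I / 2) • e₃,
        -(I / 2) • e₂ - (1 / 2 : ℂ) • e₃]

end

/-! Derivations of sl(2) are inner, so the second PostLie identity says that `x ∘ y = [φ x, y]` for
a linear map `φ`. As the centre is trivial, the first identity then says that `φ` is a Rota-Baxter
operator of weight one, and isomorphism of products becomes conjugacy of operators under
automorphisms. Automorphisms act transitively on `sl₂`-triples, so the class of `φ` is fixed once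
its values on some triple are known (`normalForm`).

Existence of a normal form: an injective `φ` equals `-1`, by a computation with adjugates
(`eq_neg_one_of_adjugate_eq`). The involution `φ ↦ -1 - φ` preserves Rota-Baxter operators and
exchanges the eigenvalues `0` and `-1`; hence `φ = 0` if `-1` is not an eigenvalue. Otherwise there
are eigenvectors `x` for `0` and `y` for `-1`. If `x` is semisimple, its weight decomposition
determines `φ` up to scaling; if `y` is, the involution reduces to that case. If both are nilpotent,
they are independent, hence not orthogonal, and rescale to the `e` and `f` of a triple, which forces
the one-parameter family.

Uniqueness: the trace separates all labels except an isolated type from one member of the family;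
such pairs differ as operators, or by having a semisimple rather than a nilpotent eigenvector. -/

/-- A Rota-Baxter operator of weight one on a complex Lie algebra. -/
def IsRotaBaxter {L : Type*} [LieRing L] [LieAlgebra ℂ L] (φ : L →ₗ[ℂ] L) : Prop :=
  ∀ z y : L, ⁅φ z, φ y⁆ = φ (⁅φ z, y⁆ + ⁅z, φ y⁆ + ⁅z, y⁆)

/-- The product `x ∘ y = [φ x, y]`. -/
def innerProduct {L : Type*} [LieRing L] [LieAlgebra ℂ L] (φ : L →ₗ[ℂ] L) : L →ₗ[ℂ] L →ₗ[ℂ] L :=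
  (LieModule.toEnd ℂ L L : L →ₗ[ℂ] Module.End ℂ L) ∘ₗ φ

/-! ### PostLie products and Rota-Baxter operators -/

section General

variable {L : Type*} [LieRing L] [LieAlgebra ℂ L]

@[simp]
theorem innerProduct_apply (φ : L →ₗ[ℂ] L) (x y : L) : innerProduct φ x y = ⁅φ x, y⁆ := rfl

theorem IsRotaBaxter.isPostLie {φ : L →ₗ[ℂ] L} (h : IsRotaBaxter φ) :
    IsPostLie (innerProduct φ) where
  assoc_rel x y z := by
    have h1 := congrArg (fun v => ⁅v, x⁆) (h z y)
    simp only [map_add, add_lie, lie_lie] at h1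
    have h2 : ⁅z, φ y⁆ = -⁅φ y, z⁆ := (lie_skew _ _).symm
    have h3 : ⁅z, y⁆ = -⁅y, z⁆ := (lie_skew _ _).symm
    rw [h2, h3, map_neg, map_neg, neg_lie, neg_lie] at h1
    simp only [innerProduct_apply]
    rw [h1]
    abel
  deriv_rel x y z := by
    simp only [innerProduct_apply]
    rw [leibniz_lie]
    abel

/-- The first PostLie identity is the Rota-Baxter identity after applying `ad`; `hL` (trivial
centre) allows `ad` to be cancelled. -/
theorem IsPostLie.isRotaBaxter {φ : L →ₗ[ℂ] L} (h : IsPostLie (innerProduct φ))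
    (hL : ∀ v : L, (∀ x : L, ⁅v, x⁆ = 0) → v = 0) : IsRotaBaxter φ := by
  intro z y
  rw [← sub_eq_zero]
  refine hL _ fun x => ?_
  have h1 := h.assoc_rel x y z
  simp only [innerProduct_apply] at h1
  have h2 : ⁅z, φ y⁆ = -⁅φ y, z⁆ := (lie_skew _ _).symm
  have h3 : ⁅z, y⁆ = -⁅y, z⁆ := (lie_skew _ _).symm
  rw [h2, h3, sub_lie, lie_lie, map_add, map_add, map_neg, map_neg, add_lie, add_lie, neg_lie,
    neg_lie, ← h1]
  abel

/-- This involution swaps the kernel with the `-1`-eigenspace, so each statement about one yields a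
statement about the other. -/
theorem IsRotaBaxter.neg_one_sub {φ : L →ₗ[ℂ] L} (h : IsRotaBaxter φ) :
    IsRotaBaxter (-LinearMap.id - φ) := by
  intro z y
  have h1 := h z y
  simp only [LinearMap.sub_apply, LinearMap.neg_apply, LinearMap.id_apply, sub_lie, neg_lie,
    lie_sub, lie_neg, map_add, map_sub, map_neg] at h1 ⊢
  rw [h1]
  abel

end General

/-! ### Coordinates on `sl(2, ℂ)` -/

/-- The traceless matrix `(p, q; r, -p)`. -/
def sl2Mk (p q r : ℂ) : SL2 := ⟨!![p, q; r, -p], by rw [mem_sl2]; simp [Matrix.trace_fin_two]⟩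

theorem exists_eq_sl2Mk (x : SL2) : ∃ p q r, x = sl2Mk p q r := by
  obtain ⟨x, hx⟩ := x
  have htr : x 1 1 = - x 0 0 := by
    have := (mem_sl2 x).1 hx
    rw [Matrix.trace_fin_two] at this
    linear_combination this
  refine ⟨x 0 0, x 0 1, x 1 0, Subtype.ext ?_⟩
  ext i j
  fin_cases i <;> fin_cases j <;> simp [sl2Mk, htr]

theorem sl2Mk_add (p q r p' q' r' : ℂ) :
    sl2Mk p q r + sl2Mk p' q' r' = sl2Mk (p + p') (q + q') (r + r') := by
  apply Subtype.ext
  ext i j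
  fin_cases i <;> fin_cases j <;> simp [sl2Mk]
  ring

theorem sl2Mk_smul (c p q r : ℂ) : c • sl2Mk p q r = sl2Mk (c * p) (c * q) (c * r) := by
  apply Subtype.ext
  ext i j
  fin_cases i <;> fin_cases j <;> simp [sl2Mk]

theorem sl2Mk_lie (p q r p' q' r' : ℂ) :
    ⁅sl2Mk p q r, sl2Mk p' q' r'⁆ =
      sl2Mk (q * r' - r * q') (2 * (p * q' - q * p')) (2 * (r * p' - p * r')) := by
  apply Subtype.ext
  change !![p, q; r, -p] * !![p', q'; r', -p'] - !![p', q'; r', -p'] * !![p, q; r, -p] = _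
  ext i j
  fin_cases i <;> fin_cases j <;> simp [sl2Mk] <;> ring

theorem sl2Mk_inj {p q r p' q' r' : ℂ} :
    sl2Mk p q r = sl2Mk p' q' r' ↔ p = p' ∧ q = q' ∧ r = r' := by
  constructor
  · intro h
    have h := congrArg (fun x : SL2 => (x : Matrix (Fin 2) (Fin 2) ℂ)) h
    have h00 := congrFun (congrFun h 0) 0
    have h01 := congrFun (congrFun h 0) 1
    have h10 := congrFun (congrFun h 1) 0
    simp [sl2Mk] at h00 h01 h10
    exact ⟨h00, h01, h10⟩
  · rintro ⟨rfl, rfl, rfl⟩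
    rfl

theorem sl2Mk_zero : sl2Mk 0 0 0 = 0 := by
  have := sl2Mk_smul 0 0 0 0
  simpa using this.symm

theorem sl2Mk_eq_zero {p q r : ℂ} : sl2Mk p q r = 0 ↔ p = 0 ∧ q = 0 ∧ r = 0 := by
  rw [← sl2Mk_zero, sl2Mk_inj]

theorem sl2_eq_zero_of_lie_eq_zero (v : SL2) (h : ∀ x : SL2, ⁅v, x⁆ = 0) : v = 0 := by
  obtain ⟨p, q, r, rfl⟩ := exists_eq_sl2Mk v
  have h1 := h (sl2Mk 1 0 0)
  have h2 := h (sl2Mk 0 1 0)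
  rw [sl2Mk_lie, sl2Mk_eq_zero] at h1 h2
  rw [sl2Mk_eq_zero]
  simp at h1 h2
  exact ⟨h2.2, h1.1, h1.2⟩

theorem e₁_eq : e₁ = sl2Mk 0 (1 / 2) (-1 / 2) := by
  apply Subtype.ext
  ext i j
  fin_cases i <;> fin_cases j <;> simp [sl2Mk, e₁]
  ring

theorem e₂_eq : e₂ = sl2Mk 0 (-Complex.I / 2) (-Complex.I / 2) := by
  apply Subtype.ext
  ext i j
  fin_cases i <;> fin_cases j <;> simp [sl2Mk, e₂, div_eq_mul_inv, mul_comm]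

theorem e₃_eq : e₃ = sl2Mk (-Complex.I / 2) 0 0 := by
  apply Subtype.ext
  ext i j
  fin_cases i <;> fin_cases j <;> simp [sl2Mk, e₃, div_eq_mul_inv, mul_comm]

theorem sl2Basis_zero : sl2Basis 0 = e₁ := by simp [sl2Basis]

theorem sl2Basis_one : sl2Basis 1 = e₂ := by simp [sl2Basis]

theorem sl2Basis_two : sl2Basis 2 = e₃ := by simp [sl2Basis]

theorem lie_e₁_e₂ : ⁅e₁, e₂⁆ = e₃ := by
  rw [e₁_eq, e₂_eq, e₃_eq, sl2Mk_lie, sl2Mk_inj]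
  refine ⟨?_, ?_, ?_⟩ <;> ring

theorem lie_e₂_e₃ : ⁅e₂, e₃⁆ = e₁ := by
  rw [e₁_eq, e₂_eq, e₃_eq, sl2Mk_lie, sl2Mk_inj]
  have := Complex.I_sq
  refine ⟨?_, ?_, ?_⟩
  · ring
  · linear_combination (-1 / 2 : ℂ) * this
  · linear_combination (1 / 2 : ℂ) * this

theorem lie_e₃_e₁ : ⁅e₃, e₁⁆ = e₂ := by
  rw [e₁_eq, e₂_eq, e₃_eq, sl2Mk_lie, sl2Mk_inj]
  refine ⟨?_, ?_, ?_⟩ <;> ring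

/-- Every PostLie product on `sl(2, ℂ)` is given by inner derivations. -/
theorem exists_eq_innerProduct {m : SL2 →ₗ[ℂ] SL2 →ₗ[ℂ] SL2} (hm : IsPostLie m) :
    ∃ φ : SL2 →ₗ[ℂ] SL2, m = innerProduct φ := by
  let A : SL2 →ₗ[ℂ] ℂ :=
    { toFun := fun x => (x : Matrix (Fin 2) (Fin 2) ℂ) 0 0
      map_add' := fun x y => by simp
      map_smul' := fun c x => by simp }
  let B : SL2 →ₗ[ℂ] ℂ :=
    { toFun := fun x => (x : Matrix (Fin 2) (Fin 2) ℂ) 0 1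
      map_add' := fun x y => by simp
      map_smul' := fun c x => by simp }
  have hA : ∀ p q r, A (sl2Mk p q r) = p := fun p q r => rfl
  have hB : ∀ p q r, B (sl2Mk p q r) = q := fun p q r => rfl
  -- If `D = ad (a h + b e + c f)` in the standard triple, then `D e = 2a e - c h` and `D f = b h -
  -- 2a f`. So `a`, `b`, `c` are read off from entries of `D e` and `D f`.
  refine ⟨((1 / 2 : ℂ) • (B ∘ₗ m.flip (sl2Mk 0 1 0))).smulRight (sl2Mk 1 0 0) +
      (A ∘ₗ m.flip (sl2Mk 0 0 1)).smulRight (sl2Mk 0 1 0) +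
      (A ∘ₗ m.flip (sl2Mk 0 1 0)).smulRight (sl2Mk 0 0 (-1)), ?_⟩
  ext z x : 2
  obtain ⟨p, q, r, rfl⟩ := exists_eq_sl2Mk x
  have h1 := hm.deriv_rel (sl2Mk 1 0 0) (sl2Mk 0 1 0) z
  have h2 := hm.deriv_rel (sl2Mk 1 0 0) (sl2Mk 0 0 1) z
  have h3 := hm.deriv_rel (sl2Mk 0 1 0) (sl2Mk 0 0 1) z
  obtain ⟨a1, b1, c1, hH⟩ := exists_eq_sl2Mk (m z (sl2Mk 1 0 0))
  obtain ⟨a2, b2, c2, hE⟩ := exists_eq_sl2Mk (m z (sl2Mk 0 1 0))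
  obtain ⟨a3, b3, c3, hF⟩ := exists_eq_sl2Mk (m z (sl2Mk 0 0 1))
  have e1 : sl2Mk (0 : ℂ) 2 0 = (2 : ℂ) • sl2Mk 0 1 0 := by rw [sl2Mk_smul]; simp
  have e2 : sl2Mk (0 : ℂ) 0 (-2) = (-2 : ℂ) • sl2Mk 0 0 1 := by rw [sl2Mk_smul]; simp
  simp only [sl2Mk_lie, mul_zero, mul_one, sub_zero, zero_sub, sub_self, mul_neg,
    sub_eq_iff_eq_add] at h1 h2 h3
  rw [e1, map_smul] at h1
  rw [e2, map_smul] at h2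
  rw [hH, hE, sl2Mk_lie, sl2Mk_lie, zero_add] at h1
  rw [hH, hF, sl2Mk_lie, sl2Mk_lie, zero_add] at h2
  rw [hH, hE, hF, sl2Mk_lie, sl2Mk_lie, zero_add] at h3
  simp only [sl2Mk_smul, sl2Mk_add, sl2Mk_inj] at h1 h2 h3
  obtain ⟨h11, h12, h13⟩ := h1
  obtain ⟨h21, h22, h23⟩ := h2
  obtain ⟨h31, h32, h33⟩ := h3
  have hx : sl2Mk p q r = p • sl2Mk 1 0 0 + q • sl2Mk 0 1 0 + r • sl2Mk 0 0 1 := by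
    simp only [sl2Mk_smul, sl2Mk_add, sl2Mk_inj]
    refine ⟨?_, ?_, ?_⟩ <;> ring
  rw [hx, map_add, map_add, map_smul, map_smul, map_smul, ← hx]
  simp only [innerProduct_apply, LinearMap.add_apply, LinearMap.smulRight_apply,
    LinearMap.smul_apply, LinearMap.comp_apply, LinearMap.flip_apply, smul_eq_mul]
  rw [hH, hE, hF]
  simp only [sl2Mk_lie, sl2Mk_smul, sl2Mk_add, hA, hB, sl2Mk_inj]
  refine ⟨?_, ?_, ?_⟩
  · linear_combination (-p / 2) * h12
  · linear_combination p * h32 - r / 4 * h22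
  · linear_combination p * h33 + q / 4 * h13 - r * h31 - r / 2 * h12

/-! ### `sl₂`-triples in `sl(2, ℂ)` -/

namespace IsSl2Triple

section General

variable {L : Type*} [LieRing L] [LieAlgebra ℂ L] {h e f : L}

theorem lie_combination (t : IsSl2Triple h e f) (a b c a' b' c' : ℂ) :
    ⁅a • h + b • e + c • f, a' • h + b' • e + c' • f⁆ =
      (b * c' - c * b') • h + (2 * (a * b' - b * a')) • e + (2 * (c * a' - a * c')) • f := by
  have h1 : ⁅h, e⁆ = (2 : ℂ) • e := t.lie_h_e_smul ℂ
  have h2 : ⁅h, f⁆ = -((2 : ℂ) • f) := t.lie_lie_smul_f ℂ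
  have h3 : ⁅e, f⁆ = h := t.lie_e_f
  have h1' : ⁅e, h⁆ = -((2 : ℂ) • e) := by rw [← lie_skew, h1]
  have h2' : ⁅f, h⁆ = (2 : ℂ) • f := by rw [← lie_skew, h2, neg_neg]
  have h3' : ⁅f, e⁆ = -h := by rw [← lie_skew, h3]
  simp only [add_lie, lie_add, smul_lie, lie_smul, lie_self, h1, h2, h3, h1', h2', h3']
  module

/-- Bracketing twice with `f` leaves only a multiple of `f` with factor `-2b`; bracketing twice with
`e` isolates `c` likewise. -/
theorem combination_eq_zero (t : IsSl2Triple h e f) {a b c : ℂ}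
    (habc : a • h + b • e + c • f = 0) : a = 0 ∧ b = 0 ∧ c = 0 := by
  have key : ∀ a b c : ℂ, a • h + b • e + c • f = 0 → b = 0 := by
    intro a b c h0
    have h1 := congrArg (fun v => ⁅v, (0 : ℂ) • h + (0 : ℂ) • e + (1 : ℂ) • f⁆) h0
    simp only [t.lie_combination, zero_lie] at h1
    have h2 := congrArg (fun v => ⁅v, (0 : ℂ) • h + (0 : ℂ) • e + (1 : ℂ) • f⁆) h1
    simp only [t.lie_combination, zero_lie] at h2
    simpa [t.f_ne_zero] using h2
  have hb := key a b c habc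
  have hc : c = 0 := by
    have h1 := congrArg (fun v => ⁅v, (0 : ℂ) • h + (1 : ℂ) • e + (0 : ℂ) • f⁆) habc
    simp only [t.lie_combination, zero_lie] at h1
    have h2 := congrArg (fun v => ⁅v, (0 : ℂ) • h + (1 : ℂ) • e + (0 : ℂ) • f⁆) h1
    simp only [t.lie_combination, zero_lie] at h2
    simpa [t.e_ne_zero] using h2
  subst hb hc
  refine ⟨?_, rfl, rfl⟩
  simpa [t.h_ne_zero] using habc

theorem combination_inj (t : IsSl2Triple h e f) {a b c a' b' c' : ℂ} :
    a • h + b • e + c • f = a' • h + b' • e + c' • f ↔ a = a' ∧ b = b' ∧ c = c' := by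
  constructor
  · intro h0
    have h1 : (a - a') • h + (b - b') • e + (c - c') • f = 0 := by
      rw [← sub_eq_zero.2 h0]
      module
    obtain ⟨h2, h3, h4⟩ := t.combination_eq_zero h1
    exact ⟨sub_eq_zero.1 h2, sub_eq_zero.1 h3, sub_eq_zero.1 h4⟩
  · rintro ⟨rfl, rfl, rfl⟩
    rfl

theorem linearIndependent (t : IsSl2Triple h e f) : LinearIndependent ℂ ![h, e, f] := by
  rw [Fintype.linearIndependent_iff]
  intro g hg
  simp only [Fin.sum_univ_three] at hg
  obtain ⟨h0, h1, h2⟩ := t.combination_eq_zero hg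
  intro i
  fin_cases i
  exacts [h0, h1, h2]

theorem smul (t : IsSl2Triple h e f) {c : ℂ} (hc : c ≠ 0) :
    IsSl2Triple h (c • e) (c⁻¹ • f) where
  h_ne_zero := t.h_ne_zero
  lie_e_f := by rw [smul_lie, lie_smul, t.lie_e_f, smul_smul, mul_inv_cancel₀ hc, one_smul]
  lie_h_e_nsmul := by rw [lie_smul, t.lie_h_e_nsmul, smul_comm]
  lie_h_f_nsmul := by rw [lie_smul, t.lie_h_f_nsmul, smul_neg, smul_comm]

/-- A triple given by its coordinates in another triple. -/
theorem of_combination (t : IsSl2Triple h e f) {a b c a₁ b₁ c₁ a₂ b₂ c₂ : ℂ}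
    (hne : a ≠ 0 ∨ b ≠ 0 ∨ c ≠ 0)
    (hef : b₁ * c₂ - c₁ * b₂ = a ∧ 2 * (a₁ * b₂ - b₁ * a₂) = b ∧ 2 * (c₁ * a₂ - a₁ * c₂) = c)
    (hhe : b * c₁ - c * b₁ = 2 * a₁ ∧ 2 * (a * b₁ - b * a₁) = 2 * b₁ ∧
      2 * (c * a₁ - a * c₁) = 2 * c₁)
    (hhf : b * c₂ - c * b₂ = -2 * a₂ ∧ 2 * (a * b₂ - b * a₂) = -2 * b₂ ∧
      2 * (c * a₂ - a * c₂) = -2 * c₂) :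
    IsSl2Triple (a • h + b • e + c • f) (a₁ • h + b₁ • e + c₁ • f) (a₂ • h + b₂ • e + c₂ • f) where
  h_ne_zero h0 := by
    obtain ⟨h1, h2, h3⟩ := t.combination_eq_zero h0
    simp_all
  lie_e_f := by rw [t.lie_combination, t.combination_inj]; exact hef
  lie_h_e_nsmul := by
    rw [t.lie_combination, hhe.1, hhe.2.1, hhe.2.2]
    module
  lie_h_f_nsmul := by
    rw [t.lie_combination, hhf.1, hhf.2.1, hhf.2.2]
    module

/-- The triple obtained by applying `exp (s • ad e)`. -/
theorem exp_ad_e (t : IsSl2Triple h e f) (s : ℂ) :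
    IsSl2Triple (h - (2 * s) • e) e (f + s • h - (s ^ 2) • e) := by
  have := t.of_combination (a := 1) (b := -2 * s) (c := 0) (a₁ := 0) (b₁ := 1) (c₁ := 0)
    (a₂ := s) (b₂ := -s ^ 2) (c₂ := 1) (by simp)
    (by refine ⟨?_, ?_, ?_⟩ <;> ring) (by refine ⟨?_, ?_, ?_⟩ <;> ring)
    (by refine ⟨?_, ?_, ?_⟩ <;> ring)
  convert this using 1 <;> module

/-- The element `e + f` is the semisimple member of a triple. -/
theorem exists_e_add_f (t : IsSl2Triple h e f) : ∃ e' f', IsSl2Triple (e + f) e' f' := by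
  have := t.of_combination (a := 0) (b := 1) (c := 1) (a₁ := 1 / 2) (b₁ := -1 / 2) (c₁ := 1 / 2)
    (a₂ := 1 / 2) (b₂ := 1 / 2) (c₂ := -1 / 2) (by simp)
    (by refine ⟨?_, ?_, ?_⟩ <;> ring) (by refine ⟨?_, ?_, ?_⟩ <;> ring)
    (by refine ⟨?_, ?_, ?_⟩ <;> ring)
  rw [show e + f = (0 : ℂ) • h + (1 : ℂ) • e + (1 : ℂ) • f by module]
  exact ⟨_, _, this⟩

/-- Up to a factor, `e - f` is the semisimple member of a triple. -/
theorem exists_e_sub_f (t : IsSl2Triple h e f) :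
    ∃ e' f', IsSl2Triple (Complex.I • (e - f)) e' f' := by
  have := (t.smul Complex.I_ne_zero).exists_e_add_f
  rwa [Complex.inv_I, neg_smul, ← sub_eq_add_neg, ← smul_sub] at this

end General

variable {H E F : SL2}

/-- The basis of `sl(2, ℂ)` given by a triple. -/
noncomputable def basis (t : IsSl2Triple H E F) : Module.Basis (Fin 3) ℂ SL2 :=
  basisOfLinearIndependentOfCardEqFinrank t.linearIndependent
    (by rw [Module.finrank_eq_card_basis sl2Basis])

theorem coe_basis (t : IsSl2Triple H E F) : ⇑t.basis = ![H, E, F] :=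
  coe_basisOfLinearIndependentOfCardEqFinrank _ _

theorem exists_eq_combination (t : IsSl2Triple H E F) (x : SL2) :
    ∃ a b c : ℂ, x = a • H + b • E + c • F := by
  refine ⟨t.basis.repr x 0, t.basis.repr x 1, t.basis.repr x 2, ?_⟩
  conv_lhs => rw [← t.basis.sum_repr x]
  simp [Fin.sum_univ_three, t.coe_basis]

theorem hom_ext (t : IsSl2Triple H E F) {M : Type*} [AddCommGroup M] [Module ℂ M]
    {φ ψ : SL2 →ₗ[ℂ] M} (hH : φ H = ψ H) (hE : φ E = ψ E) (hF : φ F = ψ F) : φ = ψ := by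
  ext x
  obtain ⟨a, b, c, rfl⟩ := t.exists_eq_combination x
  simp [hH, hE, hF]

/-- Any two triples of `sl(2, ℂ)` are conjugate under an automorphism. -/
theorem exists_lieEquiv (t : IsSl2Triple H E F) {H' E' F' : SL2} (t' : IsSl2Triple H' E' F') :
    ∃ f : SL2 ≃ₗ⁅ℂ⁆ SL2, f H = H' ∧ f E = E' ∧ f F = F' := by
  let g : SL2 ≃ₗ[ℂ] SL2 := t.basis.equiv t'.basis (Equiv.refl _)
  have hg : ∀ i, g (![H, E, F] i) = ![H', E', F'] i := by
    intro i
    rw [← t.coe_basis, ← t'.coe_basis]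
    simp [g]
  have h0 : g H = H' := hg 0
  have h1 : g E = E' := hg 1
  have h2 : g F = F' := hg 2
  refine ⟨{ g with map_lie' := ?_ }, h0, h1, h2⟩
  intro x y
  obtain ⟨a, b, c, rfl⟩ := t.exists_eq_combination x
  obtain ⟨a', b', c', rfl⟩ := t.exists_eq_combination y
  change g _ = ⁅g _, g _⁆
  rw [t.lie_combination]
  simp only [map_add, map_smul, h0, h1, h2]
  rw [t'.lie_combination]

theorem map_lieEquiv {L : Type*} [LieRing L] [LieAlgebra ℂ L] {h e f : L}
    (t : IsSl2Triple h e f) (g : L ≃ₗ⁅ℂ⁆ L) : IsSl2Triple (g h) (g e) (g f) where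
  h_ne_zero h0 := t.h_ne_zero (g.injective (by simpa using h0))
  lie_e_f := by rw [← LieEquiv.map_lie, t.lie_e_f]
  lie_h_e_nsmul := by rw [← LieEquiv.map_lie, t.lie_h_e_nsmul]; simp
  lie_h_f_nsmul := by rw [← LieEquiv.map_lie, t.lie_h_f_nsmul]; simp

end IsSl2Triple

/-! ### Nilpotent pairs and semisimple elements -/

/-- Two non-orthogonal nilpotent elements extend, after rescaling one, to a triple. -/
theorem isSl2Triple_sl2Mk {p q r p' q' r' : ℂ} (h : p ^ 2 + q * r = 0) (h' : p' ^ 2 + q' * r' = 0)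
    (hτ : 2 * p * p' + q * r' + r * q' = 1) :
    IsSl2Triple (sl2Mk (q * r' - r * q') (2 * (p * q' - q * p')) (2 * (r * p' - p * r')))
      (sl2Mk p q r) (sl2Mk p' q' r') where
  h_ne_zero h0 := by
    rw [sl2Mk_eq_zero] at h0
    obtain ⟨h1, h2, h3⟩ := h0
    have h4 : p * q' = q * p' := by linear_combination h2 / 2
    have h5 : r * p' = p * r' := by linear_combination h3 / 2
    have h6 : p = 0 := by linear_combination -p * hτ + 2 * p' * h + r * h4 - q * h5
    have h7 : q = 0 := by linear_combination -q * hτ + 2 * q' * h - 2 * p * h4 + q * h1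
    have h8 : r = 0 := by linear_combination -r * hτ + 2 * r' * h + 2 * p * h5 - r * h1
    simp [h6, h7, h8] at hτ
  lie_e_f := by rw [sl2Mk_lie]
  lie_h_e_nsmul := by
    rw [sl2Mk_lie, ← Nat.cast_smul_eq_nsmul ℂ, sl2Mk_smul, sl2Mk_inj]
    push_cast
    refine ⟨?_, ?_, ?_⟩
    · linear_combination 2 * p * hτ - 4 * p' * h
    · linear_combination 2 * q * hτ - 4 * q' * h
    · linear_combination 2 * r * hτ - 4 * r' * h
  lie_h_f_nsmul := by
    rw [sl2Mk_lie, ← Nat.cast_smul_eq_nsmul ℂ, ← neg_smul, sl2Mk_smul, sl2Mk_inj]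
    push_cast
    refine ⟨?_, ?_, ?_⟩
    · linear_combination -2 * p' * hτ + 4 * p * h'
    · linear_combination -2 * q' * hτ + 4 * q * h'
    · linear_combination -2 * r' * hτ + 4 * r * h'

/-- The matrix has eigenvalues `1` and `-1`, with eigenvectors `(1 + p, r)` and `(-q, 1 + p)`, both
nonzero as `p ≠ -1`. `E` and `F` are the nilpotent rank-one matrices with these lines as images,
scaled to fit. -/
theorem exists_isSl2Triple_of_ne_neg_one {p q r : ℂ} (h : p ^ 2 + q * r = 1) (hp : p ≠ -1) :
    ∃ E F, IsSl2Triple (sl2Mk p q r) E F := by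
  have hp' : 1 + p ≠ 0 := fun h0 => hp (by linear_combination h0)
  have h1 : (1 + p) * (1 + p)⁻¹ = 1 := mul_inv_cancel₀ hp'
  generalize (1 + p)⁻¹ = u at h1
  have h2 : q * r * u = 1 - p := by linear_combination u * h + (1 - p) * h1
  have t := isSl2Triple_sl2Mk (p := r * u / 2) (q := -1 / 2) (r := r ^ 2 * u ^ 2 / 2)
    (p' := q * (1 + p) / 2) (q' := q ^ 2 / 2) (r' := -(1 + p) ^ 2 / 2) (by ring) (by ring)
    (by linear_combination h / 2 + q * r / 2 * h1 + (q * r * u + 1 - p) / 4 * h2)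
  refine ⟨sl2Mk (r * u / 2) (-1 / 2) (r ^ 2 * u ^ 2 / 2),
    sl2Mk (q * (1 + p) / 2) (q ^ 2 / 2) (-(1 + p) ^ 2 / 2), ?_⟩
  convert t using 1
  rw [sl2Mk_inj]
  refine ⟨?_, ?_, ?_⟩
  · linear_combination (q * r * u + 1 - p) / 4 * h2
  · linear_combination -q / 2 * h2
  · linear_combination -r * u * (1 + p) / 2 * h2 - r * h1

/-- A non-nilpotent element is a multiple of the semisimple member of a triple. -/
theorem exists_smul_isSl2Triple {p q r : ℂ} (h : p ^ 2 + q * r ≠ 0) :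
    ∃ (c : ℂ) (E F : SL2), c ≠ 0 ∧ IsSl2Triple (c • sl2Mk p q r) E F := by
  obtain ⟨s, hs⟩ := IsAlgClosed.exists_pow_nat_eq (p ^ 2 + q * r) (n := 2) (by norm_num)
  have hs0 : s ≠ 0 := by
    rintro rfl
    exact h (by rw [← hs]; ring)
  have key : ∀ c : ℂ, c ≠ 0 → c ^ 2 * (p ^ 2 + q * r) = 1 → c * p ≠ -1 →
      ∃ (c : ℂ) (E F : SL2), c ≠ 0 ∧ IsSl2Triple (c • sl2Mk p q r) E F := by
    intro c hc h1 h2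
    obtain ⟨E, F, t⟩ := exists_isSl2Triple_of_ne_neg_one (p := c * p) (q := c * q) (r := c * r)
      (by linear_combination h1) h2
    exact ⟨c, E, F, hc, by rwa [sl2Mk_smul]⟩
  have h2 : s⁻¹ ^ 2 * (p ^ 2 + q * r) = 1 := by rw [← hs]; field_simp
  -- Of the two normalising factors `±s⁻¹`, at least one avoids the excluded entry `-1`.
  by_cases h3 : s⁻¹ * p = -1
  · refine key (-s⁻¹) (by simpa using hs0) (by rw [neg_sq, h2]) ?_
    rw [neg_mul, h3]
    norm_num
  · exact key s⁻¹ (by simpa using hs0) h2 h3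

/-- Two linearly independent nilpotent elements are not orthogonal. -/
theorem smul_eq_smul_of_orthogonal {p q r p' q' r' : ℂ} (h : p ^ 2 + q * r = 0)
    (h' : p' ^ 2 + q' * r' = 0) (hτ : 2 * p * p' + q * r' + r * q' = 0) :
    p • sl2Mk p' q' r' = p' • sl2Mk p q r ∧ q • sl2Mk p' q' r' = q' • sl2Mk p q r ∧
      r • sl2Mk p' q' r' = r' • sl2Mk p q r := by
  -- The form `p ^ 2 + q * r` is nondegenerate in three variables, so its totally isotropic
  -- subspaces are at most lines. Concretely, the square of each 2×2 minor is a combination of the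
  -- three hypotheses.
  have h1 : p * q' - q * p' = 0 := by
    refine pow_eq_zero_iff two_ne_zero |>.1 ?_
    linear_combination q' ^ 2 * h + q ^ 2 * h' - q * q' * hτ
  have h2 : p * r' - r * p' = 0 := by
    refine pow_eq_zero_iff two_ne_zero |>.1 ?_
    linear_combination r' ^ 2 * h + r ^ 2 * h' - r * r' * hτ
  have h3 : q * r' - r * q' = 0 := by
    refine pow_eq_zero_iff two_ne_zero |>.1 ?_
    linear_combination (q * r' + r * q' - 2 * p * p') * hτ - 4 * q' * r' * h + 4 * p ^ 2 * h'
  simp only [sl2Mk_smul, sl2Mk_inj]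
  refine ⟨⟨mul_comm _ _, ?_, ?_⟩, ⟨?_, mul_comm _ _, ?_⟩, ⟨?_, ?_, mul_comm _ _⟩⟩
  · linear_combination h1
  · linear_combination h2
  · linear_combination -h1
  · linear_combination h3
  · linear_combination -h2
  · linear_combination -h3

/-! ### Normal forms: conjugacy and separation -/

/-- The values of a normal form with given label on a triple. -/
noncomputable def normalForm {L : Type*} [LieRing L] [LieAlgebra ℂ L] (h e f : L) : Label → L × L × L
  | .type1 => (0, 0, 0)
  | .type2 => (-h, -e, -f)
  | .type3 => (0, (1 / 2 : ℂ) • h - e, -(1 / 2 : ℂ) • h - f)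
  | .type4 => (0, 0, e - f)
  | .type5 k => (k • h, 0, -f)

/-- The operator `φ` has the normal form with label `t` in the triple `(h, e, f)`. -/
structure IsNormal {L : Type*} [LieRing L] [LieAlgebra ℂ L] (φ : L →ₗ[ℂ] L) (t : Label)
    (h e f : L) : Prop where
  triple : IsSl2Triple h e f
  map_h : φ h = (normalForm h e f t).1
  map_e : φ e = (normalForm h e f t).2.1
  map_f : φ f = (normalForm h e f t).2.2

section Normal

variable {φ ψ : SL2 →ₗ[ℂ] SL2} {H E F H' E' F' : SL2}

/-- Both sides of the identity are bilinear and skew in `z, y`, so three pairs of basis vectors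
suffice. -/
theorem IsSl2Triple.isRotaBaxter (t : IsSl2Triple H E F)
    (hHE : ⁅φ H, φ E⁆ = φ (⁅φ H, E⁆ + ⁅H, φ E⁆ + ⁅H, E⁆))
    (hHF : ⁅φ H, φ F⁆ = φ (⁅φ H, F⁆ + ⁅H, φ F⁆ + ⁅H, F⁆))
    (hEF : ⁅φ E, φ F⁆ = φ (⁅φ E, F⁆ + ⁅E, φ F⁆ + ⁅E, F⁆)) : IsRotaBaxter φ := by
  have skew : ∀ x y : SL2, ⁅φ x, φ y⁆ = φ (⁅φ x, y⁆ + ⁅x, φ y⁆ + ⁅x, y⁆) →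
      ⁅φ y, φ x⁆ = φ (⁅φ y, x⁆ + ⁅y, φ x⁆ + ⁅y, x⁆) := by
    intro x y h
    rw [← lie_skew (φ y) (φ x), h, ← lie_skew (φ y) x, ← lie_skew y (φ x), ← lie_skew y x,
      ← map_neg]
    congr 1
    abel
  have self : ∀ x : SL2, ⁅φ x, φ x⁆ = φ (⁅φ x, x⁆ + ⁅x, φ x⁆ + ⁅x, x⁆) := by
    intro x
    rw [← lie_skew x (φ x), lie_self, lie_self, add_neg_cancel, add_zero, map_zero]
  have add_left : ∀ a b c : ℂ, ∀ y : SL2, ⁅φ H, φ y⁆ = φ (⁅φ H, y⁆ + ⁅H, φ y⁆ + ⁅H, y⁆) →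
      ⁅φ E, φ y⁆ = φ (⁅φ E, y⁆ + ⁅E, φ y⁆ + ⁅E, y⁆) →
      ⁅φ F, φ y⁆ = φ (⁅φ F, y⁆ + ⁅F, φ y⁆ + ⁅F, y⁆) →
      ⁅φ (a • H + b • E + c • F), φ y⁆ = φ (⁅φ (a • H + b • E + c • F), y⁆ +
        ⁅a • H + b • E + c • F, φ y⁆ + ⁅a • H + b • E + c • F, y⁆) := by
    intro a b c y h1 h2 h3
    simp only [map_add, map_smul, add_lie, smul_lie] at h1 h2 h3 ⊢
    rw [h1, h2, h3]
    module
  intro z y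
  obtain ⟨a, b, c, rfl⟩ := t.exists_eq_combination z
  obtain ⟨a', b', c', rfl⟩ := t.exists_eq_combination y
  apply add_left <;> apply skew <;> apply add_left
  exacts [self H, skew _ _ hHE, skew _ _ hHF, hHE, self E, skew _ _ hEF, hHF, hEF, self F]

theorem IsNormal.isRotaBaxter {t : Label} (h : IsNormal φ t H E F) : IsRotaBaxter φ := by
  obtain ⟨T, h1, h2, h3⟩ := h
  have b1 : ⁅H, E⁆ = (2 : ℂ) • E := T.lie_h_e_smul ℂ
  have b2 : ⁅H, F⁆ = -((2 : ℂ) • F) := T.lie_lie_smul_f ℂ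
  have b3 : ⁅E, F⁆ = H := T.lie_e_f
  have b1' : ⁅E, H⁆ = -((2 : ℂ) • E) := by rw [← lie_skew, b1]
  apply T.isRotaBaxter <;> cases t <;> simp only [normalForm] at h1 h2 h3 <;>
    simp only [h1, h2, h3, b1, b2, b3, b1', sub_lie, neg_lie, smul_lie, zero_lie, lie_sub, lie_neg, lie_smul, lie_zero, lie_self, map_add, map_sub, map_neg, map_smul,
      map_zero] <;>
    module

theorem IsNormal.isomorphicOn {t : Label} (h : IsNormal φ t H E F) (h' : IsNormal ψ t H' E' F') :
    IsomorphicOn (innerProduct φ) (innerProduct ψ) := by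
  obtain ⟨f, fH, fE, fF⟩ := h.triple.exists_lieEquiv h'.triple
  have key : (f : SL2 →ₗ[ℂ] SL2) ∘ₗ φ = ψ ∘ₗ (f : SL2 →ₗ[ℂ] SL2) := by
    apply h.triple.hom_ext <;> change f _ = ψ (f _)
    · rw [fH, h.map_h, h'.map_h]
      cases t <;> simp [normalForm, fH]
    · rw [fE, h.map_e, h'.map_e]
      cases t <;> simp [normalForm, fH, fE]
    · rw [fF, h.map_f, h'.map_f]
      cases t <;> simp [normalForm, fH, fE, fF]
  refine ⟨f, fun x y => ?_⟩
  have := LinearMap.congr_fun key x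
  simp only [innerProduct_apply, LieEquiv.map_lie]
  congr 1

theorem IsNormal.conj {t : Label} (h : IsNormal φ t H E F) (f : SL2 ≃ₗ⁅ℂ⁆ SL2)
    (hf : ∀ x, f (φ x) = ψ (f x)) : IsNormal ψ t (f H) (f E) (f F) := by
  refine ⟨h.triple.map_lieEquiv f, ?_, ?_, ?_⟩
  · rw [← hf, h.map_h]
    cases t <;> simp [normalForm]
  · rw [← hf, h.map_e]
    cases t <;> simp [normalForm]
  · rw [← hf, h.map_f]
    cases t <;> simp [normalForm]

theorem IsSl2Triple.trace_eq (t : IsSl2Triple H E F) {a b c a₁ b₁ c₁ a₂ b₂ c₂ : ℂ}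
    (hH : φ H = a • H + b • E + c • F) (hE : φ E = a₁ • H + b₁ • E + c₁ • F)
    (hF : φ F = a₂ • H + b₂ • E + c₂ • F) : LinearMap.trace ℂ SL2 φ = a + b₁ + c₂ := by
  have h0 : t.basis 0 = H := by simp [t.coe_basis]
  have h1 : t.basis 1 = E := by simp [t.coe_basis]
  have h2 : t.basis 2 = F := by simp [t.coe_basis]
  rw [LinearMap.trace_eq_matrix_trace ℂ t.basis, Matrix.trace_fin_three]
  simp only [LinearMap.toMatrix_apply]
  rw [h0, h1, h2, hH, hE, hF]
  have r0 := t.basis.repr_self 0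
  have r1 := t.basis.repr_self 1
  have r2 := t.basis.repr_self 2
  rw [h0] at r0
  rw [h1] at r1
  rw [h2] at r2
  simp [r0, r1, r2]

/-- The traces of the normal forms. -/
noncomputable def normalTrace : Label → ℂ
  | .type1 => 0
  | .type2 => -3
  | .type3 => -2
  | .type4 => -1
  | .type5 k => k - 1

theorem IsNormal.trace_eq {t : Label} (h : IsNormal φ t H E F) :
    LinearMap.trace ℂ SL2 φ = normalTrace t := by
  obtain ⟨T, h1, h2, h3⟩ := h
  cases t <;> simp only [normalForm] at h1 h2 h3
  · rw [T.trace_eq (a := 0) (b := 0) (c := 0) (a₁ := 0) (b₁ := 0) (c₁ := 0) (a₂ := 0) (b₂ := 0)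
      (c₂ := 0) (by rw [h1]; module) (by rw [h2]; module) (by rw [h3]; module)]
    simp [normalTrace]
  · rw [T.trace_eq (a := -1) (b := 0) (c := 0) (a₁ := 0) (b₁ := -1) (c₁ := 0) (a₂ := 0) (b₂ := 0)
      (c₂ := -1) (by rw [h1]; module) (by rw [h2]; module) (by rw [h3]; module)]
    norm_num [normalTrace]
  · rw [T.trace_eq (a := 0) (b := 0) (c := 0) (a₁ := 1 / 2) (b₁ := -1) (c₁ := 0) (a₂ := -(1 / 2))
      (b₂ := 0) (c₂ := -1) (by rw [h1]; module) (by rw [h2]; module) (by rw [h3]; module)]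
    norm_num [normalTrace]
  · rw [T.trace_eq (a := 0) (b := 0) (c := 0) (a₁ := 0) (b₁ := 0) (c₁ := 0) (a₂ := 0) (b₂ := 1)
      (c₂ := -1) (by rw [h1]; module) (by rw [h2]; module) (by rw [h3]; module)]
    norm_num [normalTrace]
  · rename_i k
    rw [T.trace_eq (a := k) (b := 0) (c := 0) (a₁ := 0) (b₁ := 0) (c₁ := 0) (a₂ := 0) (b₂ := 0)
      (c₂ := -1) (by rw [h1]; module) (by rw [h2]; module) (by rw [h3]; module)]
    simp [normalTrace, sub_eq_add_neg]

/-- A semisimple element is not nilpotent. -/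
theorem IsSl2Triple.h_ne_smul_e (t : IsSl2Triple H E F) (t' : IsSl2Triple H' E' F') (b : ℂ) :
    H ≠ b • E' := by
  intro h
  obtain ⟨x, y, z, hE⟩ := t'.exists_eq_combination E
  -- `ad H` has the eigenvalue `2` on `E`, while the cube of `ad (b • E')` vanishes.
  have h1 : ⁅H, ⁅H, ⁅H, E⁆⁆⁆ = (8 : ℂ) • E := by
    have h2 : ⁅H, E⁆ = (2 : ℂ) • E := t.lie_h_e_smul ℂ
    simp only [h2, lie_smul]
    module
  have h3 : H = (0 : ℂ) • H' + b • E' + (0 : ℂ) • F' := by rw [h]; module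
  rw [h3, hE, t'.lie_combination, t'.lie_combination, t'.lie_combination, ← hE] at h1
  simp only [zero_mul, mul_zero, sub_zero, zero_sub, zero_smul, sub_self, add_zero] at h1
  exact t.e_ne_zero (by simpa using h1.symm)

theorem IsSl2Triple.h_ne_smul_f (t : IsSl2Triple H E F) (t' : IsSl2Triple H' E' F') (b : ℂ) :
    H ≠ b • F' :=
  t.h_ne_smul_e t'.symm b

theorem IsNormal.not_type5_of_type1 (h : IsNormal φ .type1 H E F) (k : ℂ) :
    ¬ IsNormal φ (.type5 k) H' E' F' := by
  intro h'
  have h0 : φ = 0 := h.triple.hom_ext h.map_h h.map_e h.map_f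
  have h1 := h'.map_f
  rw [h0] at h1
  exact h'.triple.f_ne_zero (by simpa [normalForm] using h1.symm)

theorem IsNormal.not_type5_of_type2 (h : IsNormal φ .type2 H E F) (k : ℂ) :
    ¬ IsNormal φ (.type5 k) H' E' F' := by
  intro h'
  have h0 : φ = -LinearMap.id := h.triple.hom_ext h.map_h h.map_e h.map_f
  have h1 := h'.map_e
  rw [h0] at h1
  exact h'.triple.e_ne_zero (by simpa [normalForm] using h1)

/-- Equal traces force `k = -1`. The kernel is then spanned by the nilpotent `E'`, whereas type 3
kills the semisimple `H`. -/
theorem IsNormal.not_type5_of_type3 (h : IsNormal φ .type3 H E F) (k : ℂ) :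
    ¬ IsNormal φ (.type5 k) H' E' F' := by
  intro h'
  have hk := h.trace_eq.symm.trans h'.trace_eq
  simp only [normalTrace] at hk
  have hk : k = -1 := by linear_combination -hk
  subst hk
  obtain ⟨a, b, c, hH⟩ := h'.triple.exists_eq_combination H
  have h1 := h.map_h
  rw [hH, map_add, map_add, map_smul, map_smul, map_smul, h'.map_h, h'.map_e, h'.map_f] at h1
  simp only [normalForm] at h1
  obtain ⟨h2, -, h3⟩ := h'.triple.combination_eq_zero (a := -a) (b := 0) (c := -c) (by
    rw [← h1]; module)
  refine h.triple.h_ne_smul_e h'.triple b ?_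
  rw [hH, neg_eq_zero.1 h2, neg_eq_zero.1 h3]
  module

/-- Equal traces force `k = 0`. The `-1`-eigenspace is then spanned by the nilpotent `F'`, whereas
type 4 has the semisimple eigenvector `E - F`. -/
theorem IsNormal.not_type5_of_type4 (h : IsNormal φ .type4 H E F) (k : ℂ) :
    ¬ IsNormal φ (.type5 k) H' E' F' := by
  intro h'
  have hk := h.trace_eq.symm.trans h'.trace_eq
  simp only [normalTrace] at hk
  have hk : k = 0 := by linear_combination -hk
  subst hk
  obtain ⟨E₀, F₀, T⟩ := h.triple.exists_e_sub_f
  obtain ⟨a, b, c, hH⟩ := h'.triple.exists_eq_combination (Complex.I • (E - F))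
  have h1 : φ (Complex.I • (E - F)) = -(Complex.I • (E - F)) := by
    rw [map_smul, map_sub, h.map_e, h.map_f]
    simp only [normalForm]
    module
  rw [hH, map_add, map_add, map_smul, map_smul, map_smul, h'.map_h, h'.map_e, h'.map_f] at h1
  simp only [normalForm] at h1
  obtain ⟨h2, h3, -⟩ := h'.triple.combination_eq_zero (a := a) (b := b) (c := 0) (by
    rw [← sub_eq_zero] at h1
    rw [← h1]; module)
  refine T.h_ne_smul_f h'.triple c ?_
  rw [hH, h2, h3]
  module

/-- The label of a normal form is determined by the operator. -/
theorem IsNormal.label_unique {s t : Label} (h : IsNormal φ s H E F) (h' : IsNormal φ t H' E' F') :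
    s = t := by
  have htr := h.trace_eq.symm.trans h'.trace_eq
  cases s <;> cases t <;> simp only [normalTrace] at htr
  all_goals first
    | rfl
    | (exfalso; norm_num at htr; done)
    | exact absurd h' (h.not_type5_of_type1 _)
    | exact absurd h' (h.not_type5_of_type2 _)
    | exact absurd h' (h.not_type5_of_type3 _)
    | exact absurd h' (h.not_type5_of_type4 _)
    | exact absurd h (h'.not_type5_of_type1 _)
    | exact absurd h (h'.not_type5_of_type2 _)
    | exact absurd h (h'.not_type5_of_type3 _)
    | exact absurd h (h'.not_type5_of_type4 _)
    | exact congrArg Label.type5 (by linear_combination htr)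

/-- Since `ad` is injective, an isomorphism of the products intertwines the operators themselves. -/
theorem IsNormal.label_eq_of_isomorphicOn {s t : Label} (h : IsNormal φ s H E F)
    (h' : IsNormal ψ t H' E' F') (hiso : IsomorphicOn (innerProduct φ) (innerProduct ψ)) :
    s = t := by
  obtain ⟨f, hf⟩ := hiso
  refine (h.conj f fun x => ?_).label_unique h'
  rw [← sub_eq_zero]
  refine sl2_eq_zero_of_lie_eq_zero _ fun y => ?_
  have := hf x (f.symm y)
  simp only [innerProduct_apply, LieEquiv.map_lie, LieEquiv.apply_symm_apply] at this
  rw [sub_lie, this, sub_self]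

end Normal

/-! ### Triples that bring the listed products to normal form -/

/-- In this basis the bracket is the cross product. -/
theorem lie_e_combination (a b c a' b' c' : ℂ) :
    ⁅a • e₁ + b • e₂ + c • e₃, a' • e₁ + b' • e₂ + c' • e₃⁆ =
      (b * c' - c * b') • e₁ + (c * a' - a * c') • e₂ + (a * b' - b * a') • e₃ := by
  have h3 := lie_e₁_e₂
  have h1 := lie_e₂_e₃
  have h2 := lie_e₃_e₁
  have h3' : ⁅e₂, e₁⁆ = -e₃ := by rw [← lie_skew, h3]
  have h1' : ⁅e₃, e₂⁆ = -e₁ := by rw [← lie_skew, h1]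
  have h2' : ⁅e₁, e₃⁆ = -e₂ := by rw [← lie_skew, h2]
  simp only [add_lie, lie_add, smul_lie, lie_smul, lie_self, h1, h2, h3, h1', h2', h3']
  module

theorem e₁_ne_zero : e₁ ≠ 0 := linearIndependent_e.ne_zero 0

theorem e₃_ne_zero : e₃ ≠ 0 := linearIndependent_e.ne_zero 2

/-- A triple given by its coordinates in the basis `e₁, e₂, e₃`. -/
theorem isSl2Triple_of_e {a b c a₁ b₁ c₁ a₂ b₂ c₂ : ℂ} {H E F : SL2}
    (hH : H = a • e₁ + b • e₂ + c • e₃) (hE : E = a₁ • e₁ + b₁ • e₂ + c₁ • e₃)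
    (hF : F = a₂ • e₁ + b₂ • e₂ + c₂ • e₃) (hne : H ≠ 0)
    (hef : b₁ * c₂ - c₁ * b₂ = a ∧ c₁ * a₂ - a₁ * c₂ = b ∧ a₁ * b₂ - b₁ * a₂ = c)
    (hhe : b * c₁ - c * b₁ = 2 * a₁ ∧ c * a₁ - a * c₁ = 2 * b₁ ∧ a * b₁ - b * a₁ = 2 * c₁)
    (hhf : b * c₂ - c * b₂ = -2 * a₂ ∧ c * a₂ - a * c₂ = -2 * b₂ ∧ a * b₂ - b * a₂ = -2 * c₂) :
    IsSl2Triple H E F where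
  h_ne_zero := hne
  lie_e_f := by rw [hE, hF, hH, lie_e_combination, hef.1, hef.2.1, hef.2.2]
  lie_h_e_nsmul := by
    rw [hE, hH, lie_e_combination, hhe.1, hhe.2.1, hhe.2.2]
    module
  lie_h_f_nsmul := by
    rw [hF, hH, lie_e_combination, hhf.1, hhf.2.1, hhf.2.2]
    module

theorem prodOf_eq_innerProduct (v : Fin 3 → SL2) :
    prodOf v = innerProduct (sl2Basis.constr ℂ v) := by
  refine sl2Basis.ext fun i => sl2Basis.ext fun j => ?_
  simp [prodOf]

theorem constr_e₁ (v : Fin 3 → SL2) : sl2Basis.constr ℂ v e₁ = v 0 := by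
  rw [← sl2Basis_zero, Module.Basis.constr_basis]

theorem constr_e₂ (v : Fin 3 → SL2) : sl2Basis.constr ℂ v e₂ = v 1 := by
  rw [← sl2Basis_one, Module.Basis.constr_basis]

theorem constr_e₃ (v : Fin 3 → SL2) : sl2Basis.constr ℂ v e₃ = v 2 := by
  rw [← sl2Basis_two, Module.Basis.constr_basis]

section Listed

open Complex

theorem isSl2Triple_two_I_e₁ : IsSl2Triple ((2 * I) • e₁) (-e₂ - I • e₃) (e₂ - I • e₃) := by
  have hI := I_sq
  refine isSl2Triple_of_e (a := 2 * I) (b := 0) (c := 0) (a₁ := 0) (b₁ := -1) (c₁ := -I)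
    (a₂ := 0) (b₂ := 1) (c₂ := -I) (by module) (by module) (by module) (by simp [e₁_ne_zero])
    ?_ ?_ ?_
  · refine ⟨?_, ?_, ?_⟩ <;> ring
  · refine ⟨?_, ?_, ?_⟩ <;> first
      | ring1
      | linear_combination 2 * hI
  · refine ⟨?_, ?_, ?_⟩ <;> first
      | ring1
      | linear_combination 2 * hI

theorem isSl2Triple_two_I_e₃ : IsSl2Triple ((-2 * I) • e₃) (e₁ - I • e₂) (-e₁ - I • e₂) := by
  have hI := I_sq
  refine isSl2Triple_of_e (a := 0) (b := 0) (c := -2 * I) (a₁ := 1) (b₁ := -I) (c₁ := 0)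
    (a₂ := -1) (b₂ := -I) (c₂ := 0) (by module) (by module) (by module) (by simp [e₃_ne_zero])
    ?_ ?_ ?_
  · refine ⟨?_, ?_, ?_⟩ <;> ring
  · refine ⟨?_, ?_, ?_⟩ <;> first
      | ring1
      | linear_combination -2 * hI
  · refine ⟨?_, ?_, ?_⟩ <;> first
      | ring1
      | linear_combination -2 * hI

theorem e₂_sub_e₃_ne_zero : e₂ - e₃ ≠ 0 :=
  sub_ne_zero.2 fun h => absurd (linearIndependent_e.injective (a₁ := 1) (a₂ := 2) h) (by decide)

/-- This serves type 3, where `e₂` and `e₃` have the same image, so that `e₂ - e₃` is a semisimple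
kernel vector. As `ad (e₂ - e₃)` has eigenvalues with square `-2` or `0`, the condition on `c`
scales the nonzero ones to `±2`. -/
theorem isSl2Triple_e₂_sub_e₃ {c : ℂ} (hc : c ^ 2 = -2) :
    IsSl2Triple (c • (e₂ - e₃)) (-I • e₁ + (c * I / 2) • (e₂ + e₃))
      (-I • e₁ - (c * I / 2) • (e₂ + e₃)) := by
  have hI := I_sq
  have hc0 : c ≠ 0 := by
    rintro rfl
    norm_num at hc
  refine isSl2Triple_of_e (a := 0) (b := c) (c := -c) (a₁ := -I) (b₁ := c * I / 2)
    (c₁ := c * I / 2) (a₂ := -I) (b₂ := -(c * I / 2)) (c₂ := -(c * I / 2)) (by module) (by module)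
    (by module) (smul_ne_zero hc0 e₂_sub_e₃_ne_zero) ?_ ?_ ?_
  · refine ⟨?_, ?_, ?_⟩ <;> first
      | ring1
      | linear_combination c * hI
      | linear_combination -c * hI
  · refine ⟨?_, ?_, ?_⟩ <;> first
      | ring1
      | linear_combination I * hc
  · refine ⟨?_, ?_, ?_⟩ <;> first
      | ring1
      | linear_combination -I * hc

/-- Every listed product comes from an operator in normal form. -/
theorem exists_isNormal_listed (t : Label) :
    ∃ φ H E F, IsNormal φ t H E F ∧ listed t = innerProduct φ := by
  have hI := I_sq
  cases t with
  | type1 =>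
    refine ⟨0, _, _, _, ⟨isSl2Triple_two_I_e₁, rfl, rfl, rfl⟩, ?_⟩
    ext x y : 2
    simp [listed]
  | type2 =>
    refine ⟨_, _, _, _, ⟨isSl2Triple_two_I_e₁, ?_, ?_, ?_⟩, prodOf_eq_innerProduct _⟩ <;>
      simp only [normalForm, map_sub, map_smul, map_neg, constr_e₁, constr_e₂, constr_e₃,
        Matrix.cons_val] <;> module
  | type3 =>
    obtain ⟨c, hc⟩ := IsAlgClosed.exists_pow_nat_eq (-2 : ℂ) (n := 2) (by norm_num)
    refine ⟨_, _, _, _, ⟨isSl2Triple_e₂_sub_e₃ hc, ?_, ?_, ?_⟩, prodOf_eq_innerProduct _⟩ <;>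
      simp only [normalForm, map_add, map_sub, map_smul, constr_e₁, constr_e₂, constr_e₃,
        Matrix.cons_val] <;> match_scalars <;> first
      | ring1
      | linear_combination c / 2 * hI
      | linear_combination -c / 2 * hI
  | type4 =>
    -- In the triple `isSl2Triple_two_I_e₃` the operator sends `F` to `-2I • E - F`; scaling by `1 -
    -- I`, a square root of `-2I`, makes the coefficient of `E` equal to `1`.
    have h1 : (1 - I)⁻¹ = (1 + I) / 2 := by
      refine inv_eq_of_mul_eq_one_right ?_
      linear_combination (-1 / 2 : ℂ) * hI
    have h0 : (1 - I) ≠ 0 := by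
      intro h
      rw [h, inv_zero] at h1
      have := congrArg Complex.re h1
      simp at this
    have T := isSl2Triple_two_I_e₃.smul h0
    rw [h1] at T
    refine ⟨_, _, _, _, ⟨T, ?_, ?_, ?_⟩, prodOf_eq_innerProduct _⟩ <;>
      simp only [normalForm, map_sub, map_smul, map_neg, constr_e₁, constr_e₂, constr_e₃,
        Matrix.cons_val] <;> match_scalars <;> first
      | ring1
      | linear_combination (I - 1) / 2 * hI
      | linear_combination (1 - I) * hI
      | linear_combination -(5 + I) / 4 * hI
  | type5 k =>
    refine ⟨_, _, _, _, ⟨isSl2Triple_two_I_e₁, ?_, ?_, ?_⟩, prodOf_eq_innerProduct _⟩ <;>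
      simp only [normalForm, map_sub, map_smul, map_neg, constr_e₁, constr_e₂, constr_e₃,
        Matrix.cons_val] <;> match_scalars <;> first
      | ring1
      | linear_combination hI / 2

end Listed

/-! ### Bijective operators -/

open Matrix in
/-- An invertible matrix with `adj(A)ᵀ = A (tr A + 1 - Aᵀ)` is `-1`. -/
theorem eq_neg_one_of_adjugate_eq {A : Matrix (Fin 3) (Fin 3) ℂ}
    (h : A.adjugateᵀ = A * ((A.trace + 1) • (1 : Matrix (Fin 3) (Fin 3) ℂ) - Aᵀ))
    (hA : A.det ≠ 0) : A = -1 := by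
  have hu : IsUnit A := (Matrix.isUnit_iff_isUnit_det A).2 hA.isUnit
  have hu' : IsUnit Aᵀ := (Matrix.isUnit_iff_isUnit_det Aᵀ).2 (by rw [det_transpose]; exact hA.isUnit)
  have h' : A.adjugate = ((A.trace + 1) • (1 : Matrix (Fin 3) (Fin 3) ℂ) - A) * Aᵀ := by
    rw [← transpose_transpose A.adjugate, h]
    simp
  have h1 : A * (((A.trace + 1) • (1 : Matrix (Fin 3) (Fin 3) ℂ) - A) * Aᵀ) = A.det • 1 := by
    rw [← h', mul_adjugate]
  have h2 : A * ((A.trace + 1) • (1 : Matrix (Fin 3) (Fin 3) ℂ) - Aᵀ) * Aᵀ = A.det • 1 := by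
    rw [← h, ← transpose_mul, mul_adjugate]
    simp
  -- Both products equal `det A`; their difference is `A (Aᵀ - A) Aᵀ`, and the outer factors are
  -- invertible.
  have hsymm : Aᵀ = A := by
    have h3 : A * ((Aᵀ - A) * Aᵀ) = 0 := by
      have h4 : A * ((Aᵀ - A) * Aᵀ) = A * (((A.trace + 1) • (1 : Matrix (Fin 3) (Fin 3) ℂ) - A) * Aᵀ) -
          A * ((A.trace + 1) • (1 : Matrix (Fin 3) (Fin 3) ℂ) - Aᵀ) * Aᵀ := by
        noncomm_ring
      rw [h4, h1, h2, sub_self]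
    rw [hu.mul_right_eq_zero, hu'.mul_left_eq_zero] at h3
    exact sub_eq_zero.1 h3
  rw [hsymm] at h1 h'
  set t := A.trace with ht
  set d := A.det with hd
  -- Cayley-Hamilton in the form `adj A = A² - t A + s`, with `s` the second elementary symmetric
  -- function of the eigenvalues. With symmetry, the hypothesis becomes two quadratic equations for
  -- `A`; their traces give `s = -t` and `t = 3d`, and eliminating `A²` makes `A` scalar.
  obtain ⟨s, hs, hst⟩ : ∃ s : ℂ, A.adjugate = A * A - t • A + s • 1 ∧ A.adjugate.trace = s := by
    refine ⟨A 0 0 * A 1 1 - A 0 1 * A 1 0 + A 0 0 * A 2 2 - A 0 2 * A 2 0 + A 1 1 * A 2 2 -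
      A 1 2 * A 2 1, ?_, ?_⟩
    · rw [adjugate_fin_three, ht, trace_fin_three]
      ext i j
      fin_cases i <;> fin_cases j <;> simp [Matrix.mul_apply, Fin.sum_univ_three] <;> ring
    · rw [adjugate_fin_three, trace_fin_three]
      simp
      ring
  have htr : (A * A).trace = t ^ 2 - 2 * s := by
    rw [hs, trace_add, trace_sub, trace_smul, trace_smul, trace_one] at hst
    simp only [smul_eq_mul, Fintype.card_fin, ← ht] at hst
    push_cast at hst
    linear_combination hst
  have m1 : (2 : ℂ) • (A * A) = (2 * t + 1) • A - s • 1 := by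
    rw [hs, sub_mul, smul_mul_assoc, one_mul] at h'
    rw [← sub_eq_zero] at h' ⊢
    rw [← h']
    module
  have m2 : A * A + s • A = (2 * d) • 1 := by
    have h3 : A * A.adjugate = d • 1 := mul_adjugate A
    have h4 := congrArg (A * ·) m1
    simp only [mul_sub, mul_smul_comm, mul_one] at h4
    rw [hs, mul_add, mul_sub, mul_smul_comm, mul_smul_comm, mul_one] at h3
    rw [sub_mul, smul_mul_assoc, one_mul, mul_sub, mul_smul_comm] at h1
    have h5 : A * A + s • A = d • (1 : Matrix (Fin 3) (Fin 3) ℂ) + d • 1 := by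
      nth_rewrite 1 [← h3]
      rw [← h1]
      module
    rw [h5]
    module
  have e1 := congrArg trace m1
  have e2 := congrArg trace m2
  simp only [trace_add, trace_sub, trace_smul, trace_one, htr, smul_eq_mul, Fintype.card_fin,
    ← ht] at e1 e2
  push_cast at e1 e2
  have hs' : s = -t := by linear_combination -e1
  subst hs'
  have ht' : t = 3 * d := by linear_combination e2 / 2
  have hAd : A = d • 1 := by
    have h3 : A * A = (2 * d) • 1 + t • A := by
      rw [← m2]
      module
    rw [h3] at m1
    have h4 : A - (4 * d - t) • 1 = 0 := by
      rw [← sub_eq_zero.2 m1.symm]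
      module
    rw [sub_eq_zero.1 h4, ht']
    module
  have hd1 : d = -1 := by
    rw [hAd] at m2
    have h3 := congrFun (congrFun m2 0) 0
    simp at h3
    rw [ht'] at h3
    have h4 : d * (d + 1) = 0 := by linear_combination -h3 / 2
    exact eq_neg_of_add_eq_zero_left ((mul_eq_zero.1 h4).resolve_left hA)
  rw [hAd, hd1]
  simp

theorem e_combination_inj {a b c a' b' c' : ℂ} :
    a • e₁ + b • e₂ + c • e₃ = a' • e₁ + b' • e₂ + c' • e₃ ↔ a = a' ∧ b = b' ∧ c = c' := by
  constructor
  · intro h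
    have h0 := (Fintype.linearIndependent_iff.1 linearIndependent_e) ![a - a', b - b', c - c'] (by
      simp only [Fin.sum_univ_three]
      change (a - a') • e₁ + (b - b') • e₂ + (c - c') • e₃ = 0
      rw [← sub_eq_zero.2 h]
      module)
    exact ⟨sub_eq_zero.1 (h0 0), sub_eq_zero.1 (h0 1), sub_eq_zero.1 (h0 2)⟩
  · rintro ⟨rfl, rfl, rfl⟩
    rfl

open Matrix in
/-- The Rota-Baxter identity on `sl(2, ℂ)` in terms of the matrix of the operator. -/
theorem IsRotaBaxter.adjugate_eq {φ : SL2 →ₗ[ℂ] SL2} (h : IsRotaBaxter φ)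
    {A : Matrix (Fin 3) (Fin 3) ℂ} (hA : A = LinearMap.toMatrix sl2Basis sl2Basis φ) :
    A.adjugateᵀ = A * ((A.trace + 1) • (1 : Matrix (Fin 3) (Fin 3) ℂ) - Aᵀ) := by
  have hcol : ∀ j, φ (sl2Basis j) = A 0 j • e₁ + A 1 j • e₂ + A 2 j • e₃ := by
    intro j
    rw [← sl2Basis.sum_repr (φ (sl2Basis j)), Fin.sum_univ_three, sl2Basis_zero, sl2Basis_one,
      sl2Basis_two, hA]
    simp only [LinearMap.toMatrix_apply]
  have h0 := hcol 0
  have h1 := hcol 1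
  have h2 := hcol 2
  rw [sl2Basis_zero] at h0
  rw [sl2Basis_one] at h1
  rw [sl2Basis_two] at h2
  have hφ : ∀ a b c : ℂ, φ (a • e₁ + b • e₂ + c • e₃) =
      (A 0 0 * a + A 0 1 * b + A 0 2 * c) • e₁ + (A 1 0 * a + A 1 1 * b + A 1 2 * c) • e₂ +
        (A 2 0 * a + A 2 1 * b + A 2 2 * c) • e₃ := by
    intro a b c
    rw [map_add, map_add, map_smul, map_smul, map_smul, h0, h1, h2]
    module
  have add_comb : ∀ a b c a' b' c' : ℂ, a • e₁ + b • e₂ + c • e₃ +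
      (a' • e₁ + b' • e₂ + c' • e₃) = (a + a') • e₁ + (b + b') • e₂ + (c + c') • e₃ := by
    intros
    module
  -- With the bracket as cross product, `Az × Ay = adj(A)ᵀ (z × y)` and `Az × y + z × Ay = (tr A -
  -- Aᵀ)(z × y)`. The three cyclic pairs of basis vectors give the columns of the matrix identity.
  have r12 := h ((1 : ℂ) • e₁ + (0 : ℂ) • e₂ + (0 : ℂ) • e₃)
    ((0 : ℂ) • e₁ + (1 : ℂ) • e₂ + (0 : ℂ) • e₃)
  have r23 := h ((0 : ℂ) • e₁ + (1 : ℂ) • e₂ + (0 : ℂ) • e₃)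
    ((0 : ℂ) • e₁ + (0 : ℂ) • e₂ + (1 : ℂ) • e₃)
  have r31 := h ((0 : ℂ) • e₁ + (0 : ℂ) • e₂ + (1 : ℂ) • e₃)
    ((1 : ℂ) • e₁ + (0 : ℂ) • e₂ + (0 : ℂ) • e₃)
  simp only [hφ, lie_e_combination, add_comb, e_combination_inj] at r12 r23 r31
  obtain ⟨p1, p2, p3⟩ := r12
  obtain ⟨q1, q2, q3⟩ := r23
  obtain ⟨s1, s2, s3⟩ := r31
  rw [adjugate_fin_three, trace_fin_three]
  ext i j
  fin_cases i <;> fin_cases j <;> simp [Matrix.mul_apply, Fin.sum_univ_three]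
  · linear_combination q1
  · linear_combination s1
  · linear_combination p1
  · linear_combination q2
  · linear_combination s2
  · linear_combination p2
  · linear_combination q3
  · linear_combination s3
  · linear_combination p3

/-- A bijective Rota-Baxter operator of weight one on `sl(2, ℂ)` is `-1`. -/
theorem IsRotaBaxter.eq_neg_id {φ : SL2 →ₗ[ℂ] SL2} (h : IsRotaBaxter φ)
    (hφ : ∀ x, φ x = 0 → x = 0) : φ = -LinearMap.id := by
  have hdet : (LinearMap.toMatrix sl2Basis sl2Basis φ).det ≠ 0 := by
    rw [LinearMap.det_toMatrix]
    intro h0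
    obtain ⟨x, hx, hx0⟩ := (Submodule.ne_bot_iff _).1 (LinearMap.bot_lt_ker_of_det_eq_zero h0).ne'
    exact hx0 (hφ x hx)
  have h1 := eq_neg_one_of_adjugate_eq (h.adjugate_eq rfl) hdet
  apply (LinearMap.toMatrix sl2Basis sl2Basis).injective
  rw [h1, map_neg, LinearMap.toMatrix_id]

/-! ### Existence of a normal form -/

section Existence

variable {φ : SL2 →ₗ[ℂ] SL2} {H E F : SL2}

theorem IsRotaBaxter.exists_isNormal_of_map_h_map_e (h : IsRotaBaxter φ) (T : IsSl2Triple H E F)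
    (hH : φ H = 0) (hE : φ E = 0) : ∃ t H' E' F', IsNormal φ t H' E' F' := by
  obtain ⟨a, b, c, hF⟩ := T.exists_eq_combination (φ F)
  have h1 : (c + 1) • φ F = 0 := by
    have h2 : ⁅H, E⁆ = (2 : ℂ) • E := T.lie_h_e_smul ℂ
    have h3 : ⁅H, F⁆ = -((2 : ℂ) • F) := T.lie_lie_smul_f ℂ
    have h4 := h H F
    rw [hH, zero_lie, zero_lie, zero_add, hF] at h4
    simp only [lie_add, lie_smul, lie_self, h2, h3, map_add, map_smul, map_neg, hE,
      smul_zero, zero_add] at h4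
    have h5 : (c + 1) • φ F = (-1 / 2 : ℂ) • (c • -((2 : ℂ) • φ F) + -((2 : ℂ) • φ F)) := by module
    rw [h5, ← h4, smul_zero]
  rcases smul_eq_zero.1 h1 with hc | hF0
  swap
  · exact ⟨.type1, H, E, F, T, hH, hE, hF0⟩
  have hc : c = -1 := eq_neg_of_add_eq_zero_left hc
  subst hc
  -- This shear fixes `E`, keeps the new `H'` in the kernel and removes the `H`-component of `φ F`.
  -- What remains is `(b - a²) E - F'`, where the coefficient is either zero (type 5 with `k = 0`)
  -- or scaled to `1` (type 4).
  have T' := T.exp_ad_e (-a)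
  have hH' : φ (H - (2 * -a) • E) = 0 := by rw [map_sub, map_smul, hH, hE]; simp
  have hF' : φ (F + -a • H - (-a) ^ 2 • E) =
      (b - a ^ 2) • E - (F + -a • H - (-a) ^ 2 • E) := by
    rw [map_sub, map_add, map_smul, map_smul, hH, hE, hF]
    module
  generalize H - (2 * -a) • E = H' at T' hH'
  generalize F + -a • H - (-a) ^ 2 • E = F' at T' hF'
  obtain ⟨s, hs⟩ := IsAlgClosed.exists_pow_nat_eq (b - a ^ 2) (n := 2) (by norm_num)
  rcases eq_or_ne s 0 with rfl | hs0
  · refine ⟨.type5 0, H', E, F', T', ?_, hE, ?_⟩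
    · simp [normalForm, hH']
    · rw [hF', ← hs]
      simp [normalForm]
  · refine ⟨.type4, H', s • E, s⁻¹ • F', T'.smul hs0, hH', ?_, ?_⟩
    · simp [normalForm, hE]
    · simp only [normalForm]
      rw [map_smul, hF', ← hs, smul_sub, smul_smul]
      congr 2
      field_simp

/-- The kernel is a subalgebra containing `H`, so it contains the weight components of `p E + q F`,
one of which is nonzero. If that is `F`, the reversed triple applies. -/
theorem IsRotaBaxter.exists_isNormal_of_map_combination (h : IsRotaBaxter φ)
    (T : IsSl2Triple H E F) (hH : φ H = 0) {p q : ℂ} (hpq : p ≠ 0 ∨ q ≠ 0)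
    (hw : p • φ E + q • φ F = 0) : ∃ t H' E' F', IsNormal φ t H' E' F' := by
  rcases eq_or_ne p 0 with rfl | hp
  · have hF : φ F = 0 := by simpa [hpq.resolve_left (by simp)] using hw
    exact h.exists_isNormal_of_map_h_map_e T.symm (by simp [hH]) hF
  · refine h.exists_isNormal_of_map_h_map_e T hH ?_
    have h1 := h H (p • E + q • F)
    have h2 : ⁅H, E⁆ = (2 : ℂ) • E := T.lie_h_e_smul ℂ
    have h3 : ⁅H, F⁆ = -((2 : ℂ) • F) := T.lie_lie_smul_f ℂ
    rw [hH, map_add, map_smul, map_smul, hw, zero_lie, zero_lie, lie_zero, zero_add, zero_add,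
      lie_add, lie_smul, lie_smul, h2, h3] at h1
    simp only [map_add, map_smul, map_neg] at h1
    have h4 : (4 * p) • φ E = (2 : ℂ) • (p • φ E + q • φ F) +
        (p • (2 : ℂ) • φ E + q • -((2 : ℂ) • φ F)) := by module
    rw [hw, ← h1, smul_zero, zero_add] at h4
    exact (smul_eq_zero.1 h4).resolve_left (by simpa using hp)

/-- A Rota-Baxter operator that kills a semisimple element has a normal form. -/
theorem IsRotaBaxter.exists_isNormal_of_map_h (h : IsRotaBaxter φ) (T : IsSl2Triple H E F)
    (hH : φ H = 0) : ∃ t H' E' F', IsNormal φ t H' E' F' := by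
  obtain ⟨a₁, a₂, a₃, hE⟩ := T.exists_eq_combination (φ E)
  obtain ⟨b₁, b₂, b₃, hF⟩ := T.exists_eq_combination (φ F)
  have l1 : ⁅H, E⁆ = (2 : ℂ) • E := T.lie_h_e_smul ℂ
  have l2 : ⁅H, F⁆ = -((2 : ℂ) • F) := T.lie_lie_smul_f ℂ
  -- The identity on `(H, E)` and on `(H, F)` gives linear relations between `φ E` and `φ F`. A
  -- nontrivial one enlarges the kernel; if both are trivial, `φ E + E` and `φ F + F` are multiples
  -- of `H`.
  have hu : (2 * (a₂ + 1)) • φ E + (-2 * a₃) • φ F = 0 := by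
    have h1 := h H E
    rw [hH, zero_lie, zero_lie, zero_add, hE] at h1
    simp only [lie_add, lie_smul, lie_self, l1, l2, map_add, map_smul, map_neg, smul_zero,
      zero_add] at h1
    rw [h1]
    module
  have hv : (2 * b₂) • φ E + (-2 * (b₃ + 1)) • φ F = 0 := by
    have h1 := h H F
    rw [hH, zero_lie, zero_lie, zero_add, hF] at h1
    simp only [lie_add, lie_smul, lie_self, l1, l2, map_add, map_smul, map_neg, smul_zero,
      zero_add] at h1
    rw [h1]
    module
  by_cases hu0 : 2 * (a₂ + 1) ≠ 0 ∨ -2 * a₃ ≠ 0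
  · exact h.exists_isNormal_of_map_combination T hH hu0 hu
  by_cases hv0 : 2 * b₂ ≠ 0 ∨ -2 * (b₃ + 1) ≠ 0
  · exact h.exists_isNormal_of_map_combination T hH hv0 hv
  push Not at hu0 hv0
  have e1 : a₂ = -1 := by linear_combination hu0.1 / 2
  have e2 : a₃ = 0 := by linear_combination -hu0.2 / 2
  have e3 : b₂ = 0 := by linear_combination hv0.1 / 2
  have e4 : b₃ = -1 := by linear_combination -hv0.2 / 2
  subst e1 e2 e3 e4
  have hE' : φ E = a₁ • H - E := by rw [hE]; module
  have hF' : φ F = b₁ • H - F := by rw [hF]; module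
  have hab : a₁ * b₁ = -(1 / 4) := by
    have l3 : ⁅E, F⁆ = H := T.lie_e_f
    have l1' : ⁅E, H⁆ = -((2 : ℂ) • E) := by rw [← lie_skew, l1]
    have h1 := h E F
    rw [hE', hF'] at h1
    simp only [sub_lie, lie_sub, smul_lie, lie_smul, lie_self, l2, l3, l1', map_add, map_sub,
      map_smul, map_neg, hH, hE', hF'] at h1
    rw [← sub_eq_zero] at h1
    have h2 := (T.combination_eq_zero (a := 1 + 4 * a₁ * b₁) (b := 0) (c := 0) (by
      rw [← h1]
      module)).1
    linear_combination h2 / 4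
  have ha : a₁ ≠ 0 := by
    rintro rfl
    norm_num at hab
  -- This scaling turns the `H`-coefficient `a₁` into `1 / 2`; `b₁` becomes `2 * a₁ * b₁ = -1 / 2`.
  have ha' : (2 * a₁)⁻¹ ≠ 0 := by simpa using ha
  refine ⟨.type3, H, _, _, T.smul ha', hH, ?_, ?_⟩
  · simp only [normalForm]
    rw [map_smul, hE', smul_sub, smul_smul]
    congr 2
    field_simp
  · simp only [normalForm]
    rw [map_smul, hF', smul_sub, smul_smul, inv_inv]
    congr 2
    linear_combination 2 * hab

/-- A Rota-Baxter operator that has a semisimple eigenvector with eigenvalue `-1` has a normal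
form. -/
theorem IsRotaBaxter.exists_isNormal_of_map_h_eq_neg (h : IsRotaBaxter φ) (T : IsSl2Triple H E F)
    (hH : φ H = -H) : ∃ t H' E' F', IsNormal φ t H' E' F' := by
  obtain ⟨t, H', E', F', T', h1, h2, h3⟩ :=
    h.neg_one_sub.exists_isNormal_of_map_h T (by simp [hH])
  have key : ∀ x y : SL2, (-LinearMap.id - φ : SL2 →ₗ[ℂ] SL2) x = y → φ x = -x - y := by
    rintro x y rfl
    simp
  cases t with
  | type1 =>
    refine ⟨.type2, H', E', F', T', ?_, ?_, ?_⟩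
    · rw [key _ _ h1]; simp [normalForm]
    · rw [key _ _ h2]; simp [normalForm]
    · rw [key _ _ h3]; simp [normalForm]
  | type2 =>
    refine ⟨.type1, H', E', F', T', ?_, ?_, ?_⟩
    · rw [key _ _ h1]; simp [normalForm]
    · rw [key _ _ h2]; simp [normalForm]
    · rw [key _ _ h3]; simp [normalForm]
  -- When `-1 - φ` has type 3 or 4, `φ` itself kills a semisimple element (`E' + F'`, respectively a
  -- multiple of `E' - F'`), so the previous case applies to `φ` directly.
  | type3 =>
    obtain ⟨E₀, F₀, T₀⟩ := T'.exists_e_add_f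
    refine h.exists_isNormal_of_map_h T₀ ?_
    rw [map_add, key _ _ h2, key _ _ h3]
    simp only [normalForm]
    module
  | type4 =>
    obtain ⟨E₀, F₀, T₀⟩ := T'.exists_e_sub_f
    refine h.exists_isNormal_of_map_h T₀ ?_
    rw [map_smul, map_sub, key _ _ h2, key _ _ h3]
    simp only [normalForm]
    module
  | type5 k =>
    refine ⟨.type5 (-1 - k), -H', F', E', T'.symm, ?_, ?_, ?_⟩
    · rw [map_neg, key _ _ h1]; simp only [normalForm]; module
    · rw [key _ _ h3]; simp [normalForm]
    · rw [key _ _ h2]; simp [normalForm]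

/-- With `φ H = a H + b E + c F`, the pair `(H, E)` gives `c φ H = 0`, and once `c = 0` the pair
`(H, F)` gives `b (φ H + H) = 0`. In every case `H` is an eigenvector, which is type 5. -/
theorem IsRotaBaxter.exists_isNormal_of_map_e_map_f (h : IsRotaBaxter φ) (T : IsSl2Triple H E F)
    (hE : φ E = 0) (hF : φ F = -F) : ∃ t H' E' F', IsNormal φ t H' E' F' := by
  obtain ⟨a, b, c, hH⟩ := T.exists_eq_combination (φ H)
  have l1 : ⁅H, E⁆ = (2 : ℂ) • E := T.lie_h_e_smul ℂ
  have l2 : ⁅H, F⁆ = -((2 : ℂ) • F) := T.lie_lie_smul_f ℂ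
  have l3 : ⁅E, F⁆ = H := T.lie_e_f
  have l3' : ⁅F, E⁆ = -H := by rw [← lie_skew, l3]
  have h1 := h H E
  have h2 := h H F
  have hb : ∀ k : ℂ, φ H = k • H → ∃ t H' E' F', IsNormal φ t H' E' F' := fun k hk =>
    ⟨.type5 k, H, E, F, T, hk, hE, hF⟩
  have h3 : c • φ H = 0 := by
    rw [hE, lie_zero, lie_zero, add_zero, hH] at h1
    simp only [add_lie, smul_lie, lie_self, l1, l3', map_add, map_smul, map_neg, hE, smul_zero,
      zero_add, add_zero] at h1
    rw [← neg_eq_zero, ← smul_neg, ← h1]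
  rcases smul_eq_zero.1 h3 with rfl | h0
  swap
  · exact hb 0 (by rw [h0, zero_smul])
  have h4 : b • (φ H + H) = 0 := by
    rw [hF, hH] at h2
    simp only [add_lie, smul_lie, lie_neg, lie_self, l2, l3, map_add, map_smul, map_neg, hF] at h2
    rw [← sub_eq_zero] at h2
    rw [← neg_eq_zero, ← h2]
    module
  rcases smul_eq_zero.1 h4 with rfl | h0
  · exact hb a (by rw [hH]; module)
  · exact hb (-1) (by rw [eq_neg_of_add_eq_zero_left h0, neg_one_smul])

/-- Every Rota-Baxter operator of weight one on `sl(2, ℂ)` has a normal form. -/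
theorem IsRotaBaxter.exists_isNormal (h : IsRotaBaxter φ) :
    ∃ t H E F, IsNormal φ t H E F := by
  by_cases hφ : ∀ x, φ x = 0 → x = 0
  · have h0 := h.eq_neg_id hφ
    exact ⟨.type2, _, _, _, isSl2Triple_two_I_e₁, by rw [h0]; rfl, by rw [h0]; rfl,
      by rw [h0]; rfl⟩
  by_cases hψ : ∀ x, φ x = -x → x = 0
  · have h0 := h.neg_one_sub.eq_neg_id fun x hx => hψ x (by
      rw [LinearMap.sub_apply, sub_eq_zero] at hx
      exact hx.symm)
    have h0 : φ = 0 := by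
      rw [sub_eq_add_neg, add_eq_left, neg_eq_zero] at h0
      exact h0
    exact ⟨.type1, _, _, _, isSl2Triple_two_I_e₁, by rw [h0]; rfl, by rw [h0]; rfl,
      by rw [h0]; rfl⟩
  push Not at hφ hψ
  obtain ⟨x, hx, hx0⟩ := hφ
  obtain ⟨y, hy, hy0⟩ := hψ
  obtain ⟨p, q, r, rfl⟩ := exists_eq_sl2Mk x
  obtain ⟨p', q', r', rfl⟩ := exists_eq_sl2Mk y
  by_cases hn : p ^ 2 + q * r = 0
  swap
  · obtain ⟨c, E, F, -, T⟩ := exists_smul_isSl2Triple hn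
    exact h.exists_isNormal_of_map_h T (by rw [map_smul, hx, smul_zero])
  by_cases hn' : p' ^ 2 + q' * r' = 0
  swap
  · obtain ⟨c, E, F, -, T⟩ := exists_smul_isSl2Triple hn'
    exact h.exists_isNormal_of_map_h_eq_neg T (by rw [map_smul, hy, smul_neg])
  by_cases hτ : 2 * p * p' + q * r' + r * q' = 0
  · exfalso
    -- Orthogonal nilpotent elements are proportional, but `x` and `y` belong to different
    -- eigenvalues.
    have key : ∀ a b : ℂ, a • sl2Mk p' q' r' = b • sl2Mk p q r → a = 0 := by
      intro a b hab
      have h1 := congrArg φ hab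
      rw [map_smul, map_smul, hx, hy, smul_zero, smul_neg, neg_eq_zero] at h1
      exact (smul_eq_zero.1 h1).resolve_right hy0
    obtain ⟨h1, h2, h3⟩ := smul_eq_smul_of_orthogonal hn hn' hτ
    exact hx0 (sl2Mk_eq_zero.2 ⟨key _ _ h1, key _ _ h2, key _ _ h3⟩)
  · set τ := 2 * p * p' + q * r' + r * q' with hτ'
    have T := isSl2Triple_sl2Mk (p' := τ⁻¹ * p') (q' := τ⁻¹ * q') (r' := τ⁻¹ * r') hn
      (by linear_combination τ⁻¹ ^ 2 * hn')
      (by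
        have h1 : τ⁻¹ * τ = 1 := inv_mul_cancel₀ hτ
        rw [hτ'] at h1 ⊢
        linear_combination h1)
    exact h.exists_isNormal_of_map_e_map_f T hx
      (by rw [← sl2Mk_smul, map_smul, hy, smul_neg])

end Existence

/-- The products in the list are PostLie algebra structures on `sl(2, ℂ)`; every PostLie algebra
structure on `sl(2, ℂ)` is isomorphic on `sl(2, ℂ)` to a listed one; and listed products with
different labels are not isomorphic. -/
theorem theorem1 :
    (∀ t : Label, IsPostLie (listed t)) ∧
    (∀ m : SL2 →ₗ[ℂ] SL2 →ₗ[ℂ] SL2, IsPostLie m → ∃ t : Label, IsomorphicOn m (listed t)) ∧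
    (∀ s t : Label, IsomorphicOn (listed s) (listed t) → s = t) := by
  refine ⟨fun t => ?_, fun m hm => ?_, fun s t hst => ?_⟩
  · obtain ⟨φ, H, E, F, h, ht⟩ := exists_isNormal_listed t
    rw [ht]
    exact h.isRotaBaxter.isPostLie
  · obtain ⟨φ, rfl⟩ := exists_eq_innerProduct hm
    obtain ⟨t, H, E, F, h⟩ := (hm.isRotaBaxter sl2_eq_zero_of_lie_eq_zero).exists_isNormal
    obtain ⟨ψ, H', E', F', h', ht⟩ := exists_isNormal_listed t
    refine ⟨t, ?_⟩
    rw [ht]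
    exact h.isomorphicOn h'
  · obtain ⟨φ, H, E, F, h, hs⟩ := exists_isNormal_listed s
    obtain ⟨ψ, H', E', F', h', ht⟩ := exists_isNormal_listed t
    rw [hs, ht] at hst
    exact h.label_eq_of_isomorphicOn h' hst
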